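/- Fix two distinct horizontal lines in the plane. A set is *spanned between* the two lines if it is arc-connected, is contained in the closed strip between the lines, and has non-empty intersection with each of the two lines. Such a set is *quasi-convex* if it contains a segment that has one endpoint on each of the two lines. A graph $G$ is an *intersection graph* of a family $\mathcal F$ of sets if the vertices of $G$ and the members of $\mathcal F$ are in bijection such that two distinct vertices are adjacent in $G$ if and only if the corresponding sets intersect. The *cocomparability graph* of a poset has the elements of the poset as vertices, two elements being adjacent if and only if they are incomparable. A poset is *convex* (respectively *quasi-convex*) if its cocomparability graph is an intersection graph of a family of convex (respectively quasi-convex) sets spanned between two horizontal lines. **Proposition.** Every convex poset is quasi-convex, and there exists a finite poset that is quasi-convex but not convex. Thus the class of quasi-convex posets properly contains the class of convex posets. -/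

import Mathlib

/-- The cocomparability graph of a poset: distinct elements are adjacent if and only if they are
incomparable. -/
def cocomparabilityGraph (P : Type*) [PartialOrder P] : SimpleGraph P where
  Adj x y := ¬ x ≤ y ∧ ¬ y ≤ x
  symm := ⟨fun _ _ h => ⟨h.2, h.1⟩⟩
  loopless := ⟨fun _ h => h.1 le_rfl⟩

/-- `G` is an intersection graph of the family `F` of sets: its vertices are in bijection with the
members of `F`, and two distinct vertices are adjacent if and only if the corresponding sets
intersect. -/
def IsIntersectionGraph {V X : Type*} (G : SimpleGraph V) (F : Set (Set X)) : Prop :=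
  ∃ φ : V ≃ F, ∀ u v : V, u ≠ v →
    (G.Adj u v ↔ ((φ u : Set X) ∩ (φ v : Set X)).Nonempty)

/-- A set in the plane is spanned between the horizontal lines `y = a` and `y = b` (with `a < b`):
it is arc-connected, contained in the closed strip between the lines, and meets both lines. -/
structure SpannedBetween (a b : ℝ) (s : Set (ℝ × ℝ)) : Prop where
  isPathConnected : IsPathConnected s
  subset_strip : ∀ p ∈ s, a ≤ p.2 ∧ p.2 ≤ b
  meets_lower : ∃ p ∈ s, p.2 = a
  meets_upper : ∃ p ∈ s, p.2 = b

/-- A set spanned between the lines `y = a` and `y = b` is quasi-convex if it contains a segment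
with one endpoint on each of the two lines. -/
structure IsQuasiConvexBetween (a b : ℝ) (s : Set (ℝ × ℝ)) : Prop
    extends SpannedBetween a b s where
  exists_base_segment : ∃ p q : ℝ × ℝ, p.2 = a ∧ q.2 = b ∧ segment ℝ p q ⊆ s

/-- A poset is convex if its cocomparability graph is an intersection graph of convex sets spanned
between two horizontal lines. -/
def IsConvexPoset (P : Type*) [PartialOrder P] : Prop :=
  ∃ a b : ℝ, a < b ∧ ∃ F : Set (Set (ℝ × ℝ)),
    (∀ s ∈ F, SpannedBetween a b s ∧ Convex ℝ s) ∧
      IsIntersectionGraph (cocomparabilityGraph P) F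

/-- A poset is quasi-convex if its cocomparability graph is an intersection graph of quasi-convex
sets spanned between two horizontal lines. -/
def IsQuasiConvexPoset (P : Type*) [PartialOrder P] : Prop :=
  ∃ a b : ℝ, a < b ∧ ∃ F : Set (Set (ℝ × ℝ)),
    (∀ s ∈ F, IsQuasiConvexBetween a b s) ∧
      IsIntersectionGraph (cocomparabilityGraph P) F

/-! ### Convex posets are quasi-convex -/

/-! A convex set meeting both lines contains a segment joining them, which gives the inclusion. The
separating example is read off a drawing by vertical or slanted segments with horizontal spikes. In
the drawing, `left i` and `right i` touch only at a tip at height `i + 1`; the tips zigzag across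
two walls: between them, right, left, right, between. The `rake` stays left of the right wall and
left of `right 2`, and meets `right 0` and `right 4`. In a convex representation, disjoint sets are
ordered left to right, and incomparabilities propagate one choice of orientation to all the pairs
needed (up to reflection). The transversals `falling k` and `rising k` then force the tips to occur
in monotone order of height. Tips 1 and 3, right of the right wall, confine the two contacts of the
rake beyond them, so tip 2 lies at a height between the contacts. By convexity the rake passes right
of the left wall at that height, hence right of tip 2, which is impossible since it is left of
`right 2`. -/

theorem IsConvexPoset.isQuasiConvexPoset {P : Type*} [PartialOrder P] (h : IsConvexPoset P) :
    IsQuasiConvexPoset P := by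
  obtain ⟨a, b, hab, F, hF, hG⟩ := h
  refine ⟨a, b, hab, F, fun s hs => ⟨(hF s hs).1, ?_⟩, hG⟩
  obtain ⟨p, hp, hpa⟩ := (hF s hs).1.meets_lower
  obtain ⟨q, hq, hqb⟩ := (hF s hs).1.meets_upper
  exact ⟨p, q, hpa, hqb, (hF s hs).2.segment_subset hp hq⟩

/-! ### Spiked segments -/

/-- A segment `x = base + slope * t`, `0 ≤ t ≤ 6`, together with horizontal spikes `[lo k, hi k]`
through it at the heights `k + 1`. -/
structure SpikedSegment where
  base : ℤ
  slope : ℤ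
  lo : Fin 5 → ℤ
  hi : Fin 5 → ℤ
  lo_le : ∀ k, lo k ≤ base + slope * (k.val + 1)
  le_hi : ∀ k, base + slope * (k.val + 1) ≤ hi k

namespace SpikedSegment

/-- Being disjoint from and to the left of another spiked segment. -/
def LeftOf (S T : SpikedSegment) : Prop :=
  S.base < T.base ∧ S.base + S.slope * 6 < T.base + T.slope * 6 ∧ ∀ k, S.hi k < T.lo k

instance (S T : SpikedSegment) : Decidable (S.LeftOf T) :=
  inferInstanceAs (Decidable (_ ∧ _ ∧ _))

theorem LeftOf.trans {S T U : SpikedSegment} (h : S.LeftOf T) (h' : T.LeftOf U) : S.LeftOf U :=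
  ⟨h.1.trans h'.1, h.2.1.trans h'.2.1, fun k =>
    (h.2.2 k).trans (((T.lo_le k).trans (T.le_hi k)).trans_lt (h'.2.2 k))⟩

instance : PartialOrder SpikedSegment where
  le S T := S = T ∨ S.LeftOf T
  le_refl _ := Or.inl rfl
  le_trans := by
    rintro S T U (rfl | h) (rfl | h')
    exacts [Or.inl rfl, Or.inr h', Or.inr h, Or.inr (h.trans h')]
  le_antisymm := by
    rintro S T (h | h) (h' | h')
    exacts [h, h, h'.symm, absurd h.1 h'.1.not_gt]

/-- The point set of a spiked segment. -/
def body (S : SpikedSegment) : Set (ℝ × ℝ) :=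
  {p | 0 ≤ p.2 ∧ p.2 ≤ 6 ∧ (p.1 = S.base + S.slope * p.2 ∨
    ∃ k : Fin 5, p.2 = k.val + 1 ∧ (S.lo k : ℝ) ≤ p.1 ∧ p.1 ≤ S.hi k)}

theorem lo_le_cast (S : SpikedSegment) (k : Fin 5) :
    (S.lo k : ℝ) ≤ S.base + S.slope * (k.val + 1) := by
  exact_mod_cast S.lo_le k

theorem le_hi_cast (S : SpikedSegment) (k : Fin 5) :
    (S.base + S.slope * (k.val + 1) : ℝ) ≤ S.hi k := by
  exact_mod_cast S.le_hi k

theorem base_mem_body (S : SpikedSegment) {t : ℝ} (h0 : 0 ≤ t) (h6 : t ≤ 6) :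
    ((S.base + S.slope * t, t) : ℝ × ℝ) ∈ S.body :=
  ⟨h0, h6, Or.inl rfl⟩

theorem spike_mem_body (S : SpikedSegment) (k : Fin 5) {x : ℝ} (h : S.lo k ≤ x) (h' : x ≤ S.hi k) :
    ((x, k.val + 1) : ℝ × ℝ) ∈ S.body := by
  have hk : (k.val : ℝ) ≤ 4 := by exact_mod_cast Nat.le_of_lt_succ k.2
  exact ⟨by positivity, by dsimp only; linarith, Or.inr ⟨k, rfl, h, h'⟩⟩

theorem bounds_of_mem_body {S : SpikedSegment} {p : ℝ × ℝ} (hp : p ∈ S.body) (k : Fin 5)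
    (hk : p.2 = k.val + 1) : (S.lo k : ℝ) ≤ p.1 ∧ p.1 ≤ S.hi k := by
  obtain ⟨-, -, h | ⟨j, hj, h⟩⟩ := hp
  · rw [h, hk]
    exact ⟨S.lo_le_cast k, S.le_hi_cast k⟩
  · have : (j.val : ℝ) = k.val := by linarith
    have : j = k := Fin.ext (by exact_mod_cast this)
    exact this ▸ h

theorem base_segment_subset_body (S : SpikedSegment) :
    segment ℝ ((S.base, 0) : ℝ × ℝ) (S.base + S.slope * 6, 6) ⊆ S.body := by
  rintro _ ⟨α, β, hα, hβ, hαβ, rfl⟩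
  refine ⟨?_, ?_, Or.inl ?_⟩ <;> simp
  · exact hβ
  · linarith
  · linear_combination (S.base : ℝ) * hαβ

theorem isPathConnected_body (S : SpikedSegment) : IsPathConnected S.body := by
  have hbase : ∀ t : ℝ, 0 ≤ t → t ≤ 6 →
      JoinedIn S.body ((S.base, 0) : ℝ × ℝ) (S.base + S.slope * t, t) := by
    intro t h0 h6
    refine JoinedIn.of_segment_subset fun p hp => S.base_segment_subset_body ?_
    refine (convex_segment _ _).segment_subset (left_mem_segment _ _ _) ?_ hp
    refine ⟨1 - t / 6, t / 6, by linarith, by positivity, by ring, ?_⟩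
    ext
    · simp; ring
    · simp
  refine ⟨((S.base, 0) : ℝ × ℝ), ?_, ?_⟩
  · simpa using S.base_mem_body le_rfl (by norm_num)
  · rintro ⟨x, t⟩ ⟨h0, h6, h⟩
    dsimp only at h0 h6 h
    obtain rfl | ⟨k, rfl, h, h'⟩ := h
    · exact hbase t h0 h6
    · refine (hbase _ h0 h6).trans (JoinedIn.of_segment_subset ?_)
      have hspike : Convex ℝ (Set.Icc (S.lo k : ℝ) (S.hi k) ×ˢ {(k.val + 1 : ℝ)}) :=
        (convex_Icc _ _).prod (convex_singleton _)
      refine (hspike.segment_subset ⟨⟨S.lo_le_cast k, S.le_hi_cast k⟩, Set.mem_singleton _⟩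
        ⟨⟨h, h'⟩, Set.mem_singleton _⟩).trans ?_
      rintro ⟨y, t⟩ ⟨⟨hy, hy'⟩, ht⟩
      obtain rfl : t = k.val + 1 := ht
      exact S.spike_mem_body k hy hy'

theorem isQuasiConvexBetween_body (S : SpikedSegment) : IsQuasiConvexBetween 0 6 S.body where
  isPathConnected := S.isPathConnected_body
  subset_strip _ hp := ⟨hp.1, hp.2.1⟩
  meets_lower := ⟨_, S.base_mem_body le_rfl (by norm_num), rfl⟩
  meets_upper := ⟨_, S.base_mem_body (by norm_num) le_rfl, rfl⟩
  exists_base_segment := ⟨_, _, rfl, rfl, S.base_segment_subset_body⟩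

/-! ### Intersection pattern of spiked segments -/

/-- At spike heights the bounds `hi` and `lo` separate the bodies. Elsewhere only the segments
remain, and their affine difference is positive at both ends. -/
theorem LeftOf.disjoint {S T : SpikedSegment} (h : S.LeftOf T) : Disjoint S.body T.body := by
  rw [Set.disjoint_left]
  intro p hp hq
  obtain ⟨h0, h6, hlohi⟩ := h
  have key : ∀ k : Fin 5, p.2 ≠ k.val + 1 := by
    intro k hk
    have hST : (S.hi k : ℝ) < T.lo k := by exact_mod_cast hlohi k
    linarith [(bounds_of_mem_body hp k hk).2, (bounds_of_mem_body hq k hk).1]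
  obtain ⟨ht, ht', hS | ⟨k, hk, -⟩⟩ := hp
  swap
  · exact key k hk
  obtain ⟨-, -, hT | ⟨k, hk, -⟩⟩ := hq
  swap
  · exact key k hk
  have h0' : (S.base : ℝ) < T.base := by exact_mod_cast h0
  have h6' : (S.base + S.slope * 6 : ℝ) < T.base + T.slope * 6 := by exact_mod_cast h6
  obtain ht | ht := ht.eq_or_lt
  · rw [← ht] at hS hT
    linarith
  · nlinarith [mul_pos ht (sub_pos.2 h6'), mul_nonneg (sub_nonneg.2 ht') (sub_pos.2 h0').le]

theorem inter_nonempty_of_cross {S T : SpikedSegment} (h0 : S.base ≤ T.base)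
    (h6 : T.base + T.slope * 6 ≤ S.base + S.slope * 6) : (S.body ∩ T.body).Nonempty := by
  obtain hs | hs := eq_or_ne S.slope T.slope
  · have : S.base = T.base := by omega
    refine ⟨_, S.base_mem_body le_rfl (by norm_num), ?_⟩
    rw [this, hs]
    exact T.base_mem_body le_rfl (by norm_num)
  · have hlt : T.slope < S.slope := by omega
    have hlt' : (0 : ℝ) < S.slope - T.slope := by
      have : (T.slope : ℝ) < S.slope := by exact_mod_cast hlt
      linarith
    have h0' : (S.base : ℝ) ≤ T.base := by exact_mod_cast h0
    have h6' : (T.base + T.slope * 6 : ℝ) ≤ S.base + S.slope * 6 := by exact_mod_cast h6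
    have ht0 : (0 : ℝ) ≤ (T.base - S.base) / (S.slope - T.slope) :=
      div_nonneg (by linarith) hlt'.le
    have ht6 : ((T.base - S.base) / (S.slope - T.slope) : ℝ) ≤ 6 := by
      rw [div_le_iff₀ hlt']; linarith
    refine ⟨_, S.base_mem_body ht0 ht6, ht0, ht6, Or.inl ?_⟩
    dsimp only
    field_simp
    ring

theorem inter_nonempty_of_base_lt {S T : SpikedSegment} (h0 : S.base < T.base)
    (h6 : S.base + S.slope * 6 < T.base + T.slope * 6) (h : ¬ S.LeftOf T) :
    (S.body ∩ T.body).Nonempty := by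
  have : ∃ k, T.lo k ≤ S.hi k := by
    by_contra! hc
    exact h ⟨h0, h6, hc⟩
  obtain ⟨k, hk⟩ := this
  have hk' : (T.lo k : ℝ) ≤ S.hi k := by exact_mod_cast hk
  have h0' : (S.base : ℝ) < T.base := by exact_mod_cast h0
  have h6' : (S.base + S.slope * 6 : ℝ) < T.base + T.slope * 6 := by exact_mod_cast h6
  have hk0 : (0 : ℝ) ≤ k.val := by positivity
  have hk4 : (k.val : ℝ) ≤ 4 := by exact_mod_cast Nat.le_of_lt_succ k.2
  have hlt : (S.base + S.slope * (k.val + 1) : ℝ) < T.base + T.slope * (k.val + 1) := by nlinarith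
  have hS := S.lo_le_cast k
  have hS' := S.le_hi_cast k
  have hT := T.lo_le_cast k
  have hT' := T.le_hi_cast k
  -- The smaller of the two right ends lies on both spikes.
  obtain hle | hle := le_total (S.hi k : ℝ) (T.hi k)
  · exact ⟨_, S.spike_mem_body k (by linarith) le_rfl, T.spike_mem_body k hk' hle⟩
  · exact ⟨_, S.spike_mem_body k (by linarith) hle, T.spike_mem_body k (by linarith) le_rfl⟩

theorem inter_nonempty_iff {S T : SpikedSegment} :
    (S.body ∩ T.body).Nonempty ↔ ¬ S.LeftOf T ∧ ¬ T.LeftOf S := by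
  refine ⟨fun h => ⟨fun hl => ?_, fun hl => ?_⟩, fun ⟨h, h'⟩ => ?_⟩
  · exact Set.not_disjoint_iff_nonempty_inter.2 h hl.disjoint
  · exact Set.not_disjoint_iff_nonempty_inter.2 h hl.disjoint.symm
  · obtain h0 | h0 := lt_or_ge S.base T.base
    · obtain h6 | h6 := lt_or_ge (S.base + S.slope * 6) (T.base + T.slope * 6)
      · exact inter_nonempty_of_base_lt h0 h6 h
      · exact inter_nonempty_of_cross h0.le h6
    · rw [Set.inter_comm]
      obtain h6 | h6 := le_or_gt (S.base + S.slope * 6) (T.base + T.slope * 6)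
      · exact inter_nonempty_of_cross h0 h6
      · obtain h0 | h0 := h0.lt_or_eq
        · exact inter_nonempty_of_base_lt h0 h6 h'
        · rw [Set.inter_comm]
          exact inter_nonempty_of_cross h0.ge h6.le

/-- There are no spikes at heights 0 and 6, so the body determines the ends of its segment. Distinct
vertices thus get distinct sets, as the bijection with the family requires. -/
theorem base_eq_of_body_eq {S T : SpikedSegment} (h : S.body = T.body) : S.base = T.base := by
  have hmem := S.base_mem_body le_rfl (by norm_num : (0 : ℝ) ≤ 6)
  rw [h] at hmem
  obtain ⟨-, -, h | ⟨k, hk, -⟩⟩ := hmem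
  · simpa using h
  · have : (0 : ℝ) ≤ k.val := by positivity
    dsimp only at hk
    linarith

theorem slope_eq_of_body_eq {S T : SpikedSegment} (h : S.body = T.body) : S.slope = T.slope := by
  have hmem := S.base_mem_body (by norm_num : (0 : ℝ) ≤ 6) le_rfl
  rw [h] at hmem
  obtain ⟨-, -, h' | ⟨k, hk, -⟩⟩ := hmem
  · simpa [base_eq_of_body_eq h] using h'
  · have hk4 : (k.val : ℝ) ≤ 4 := by exact_mod_cast Nat.le_of_lt_succ k.2
    dsimp only at hk
    linarith

end SpikedSegment

/-- A poset embedded into the spiked segments by a map under which the underlying segments are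
distinct is quasi-convex. -/
theorem isQuasiConvexPoset_of_spikedSegment {P : Type*} [PartialOrder P] (f : P ↪o SpikedSegment)
    (hf : ∀ v w, (f v).base = (f w).base → (f v).slope = (f w).slope → v = w) :
    IsQuasiConvexPoset P := by
  have hinj : Function.Injective fun v => (f v).body := fun v w h =>
    hf v w (SpikedSegment.base_eq_of_body_eq h) (SpikedSegment.slope_eq_of_body_eq h)
  refine ⟨0, 6, by norm_num, Set.range fun v => (f v).body, ?_, Equiv.ofInjective _ hinj, ?_⟩
  · rintro _ ⟨v, rfl⟩
    exact (f v).isQuasiConvexBetween_body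
  · intro v w hvw
    have hne : f v ≠ f w := f.injective.ne hvw
    have hle : ∀ v w, f v ≠ f w → (v ≤ w ↔ (f v).LeftOf (f w)) := fun v w hne =>
      f.le_iff_le.symm.trans ⟨fun h => h.resolve_left hne, Or.inr⟩
    change ¬ v ≤ w ∧ ¬ w ≤ v ↔ ((f v).body ∩ (f w).body).Nonempty
    rw [SpikedSegment.inter_nonempty_iff, hle v w hne, hle w v hne.symm]

/-! ### Convex sets spanned between two lines -/

/-- `A` is to the left of `B` at every height. -/
def IsLeftOf (A B : Set (ℝ × ℝ)) : Prop :=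
  ∀ p ∈ A, ∀ q ∈ B, p.2 = q.2 → p.1 < q.1

theorem exists_mem_height_eq {A : Set (ℝ × ℝ)} (hA : Convex ℝ A) {p q : ℝ × ℝ} (hp : p ∈ A)
    (hq : q ∈ A) {t : ℝ} (h : p.2 ≤ t) (h' : t ≤ q.2) : ∃ m ∈ A, m.2 = t := by
  have hconv : Convex ℝ (Prod.snd '' A) := hA.linear_image (LinearMap.snd ℝ ℝ ℝ)
  exact hconv.ordConnected.out (Set.mem_image_of_mem _ hp) (Set.mem_image_of_mem _ hq) ⟨h, h'⟩

/-- If the order differed at two heights, the horizontal gap would change sign along two chords with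
matching heights; weighting each end by the gap at the other yields a common point. -/
theorem isLeftOf_or_isLeftOf {A B : Set (ℝ × ℝ)} (hA : Convex ℝ A) (hB : Convex ℝ B)
    (hAB : Disjoint A B) : IsLeftOf A B ∨ IsLeftOf B A := by
  by_contra! h
  simp only [IsLeftOf] at h
  push Not at h
  obtain ⟨⟨p, hp, q, hq, hpq, hle⟩, q', hq', p', hp', hpq', hle'⟩ := h
  have hne : ∀ p ∈ A, ∀ q ∈ B, p.2 = q.2 → p.1 ≠ q.1 := fun p hp q hq h h' =>
    Set.disjoint_left.1 hAB hp (Prod.ext h' h ▸ hq)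
  have hlt : 0 < p.1 - q.1 := sub_pos.2 (lt_of_le_of_ne hle (hne p hp q hq hpq).symm)
  have hlt' : 0 < q'.1 - p'.1 := sub_pos.2 (lt_of_le_of_ne hle' (hne p' hp' q' hq' hpq'.symm))
  have hD : 0 < (q'.1 - p'.1) + (p.1 - q.1) := by positivity
  have hsum : (q'.1 - p'.1) / ((q'.1 - p'.1) + (p.1 - q.1)) +
      (p.1 - q.1) / ((q'.1 - p'.1) + (p.1 - q.1)) = 1 := by
    rw [← add_div, div_self hD.ne']
  have hmA := hA hp hp' (div_nonneg hlt'.le hD.le) (div_nonneg hlt.le hD.le) hsum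
  have hmB := hB hq hq' (div_nonneg hlt'.le hD.le) (div_nonneg hlt.le hD.le) hsum
  refine hne _ hmA _ hmB ?_ ?_
  · simp [hpq, hpq']
  · simp only [Prod.fst_add, Prod.smul_fst, smul_eq_mul]
    field_simp
    ring

theorem exists_line_subset {A : Set (ℝ × ℝ)} (hA : Convex ℝ A) {a b : ℝ} (hab : a < b)
    (hS : SpannedBetween a b A) :
    ∃ c s : ℝ, ∀ t, a ≤ t → t ≤ b → (c + s * t, t) ∈ A := by
  obtain ⟨⟨x, _⟩, hp, rfl⟩ := hS.meets_lower
  obtain ⟨⟨y, _⟩, hq, rfl⟩ := hS.meets_upper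
  dsimp only at hab ⊢
  rename_i a b
  have hD : 0 < b - a := sub_pos.2 hab
  refine ⟨x - (y - x) / (b - a) * a, (y - x) / (b - a), fun t h h' => ?_⟩
  have hsum : (b - t) / (b - a) + (t - a) / (b - a) = 1 := by
    rw [← add_div, div_eq_one_iff_eq hD.ne']; ring
  convert hA hp hq (div_nonneg (sub_nonneg.2 h') hD.le) (div_nonneg (sub_nonneg.2 h) hD.le) hsum
    using 1
  ext
  · simp only [Prod.fst_add, Prod.smul_fst, smul_eq_mul]
    field_simp
    ring
  · simp only [Prod.snd_add, Prod.smul_snd, smul_eq_mul]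
    field_simp
    ring

theorem convex_left_of_line (c s : ℝ) : Convex ℝ {p : ℝ × ℝ | p.1 < c + s * p.2} := by
  intro p hp q hq α β hα hβ hαβ
  simp only [Set.mem_ofPred_eq, Prod.fst_add, Prod.smul_fst, Prod.snd_add, Prod.smul_snd,
    smul_eq_mul] at *
  obtain rfl : α = 1 - β := by linarith
  obtain rfl | hβ := hβ.eq_or_lt
  · linarith
  · nlinarith [mul_lt_mul_of_pos_left hq hβ, mul_le_mul_of_nonneg_left hp.le hα]

theorem convex_right_of_line (c s : ℝ) : Convex ℝ {p : ℝ × ℝ | c + s * p.2 < p.1} := by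
  intro p hp q hq α β hα hβ hαβ
  simp only [Set.mem_ofPred_eq, Prod.fst_add, Prod.smul_fst, Prod.snd_add, Prod.smul_snd,
    smul_eq_mul] at *
  obtain rfl : α = 1 - β := by linarith
  obtain rfl | hβ := hβ.eq_or_lt
  · linarith
  · nlinarith [mul_lt_mul_of_pos_left hq hβ, mul_le_mul_of_nonneg_left hp.le hα]

/-- If `B` is to the left of the convex set `A`, and a point `e` of `B` is to the right of a line
which has the points `p` and `q` of `A` to its left, then `e` is not at a height between `p` and
`q`. -/
theorem not_between_of_left_of_line {A B : Set (ℝ × ℝ)} (hA : Convex ℝ A) (hBA : IsLeftOf B A)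
    {c s : ℝ} {p q e : ℝ × ℝ} (hp : p ∈ A) (hq : q ∈ A) (he : e ∈ B)
    (hpl : p.1 < c + s * p.2) (hql : q.1 < c + s * q.2) (hel : c + s * e.2 < e.1)
    (h : p.2 ≤ e.2) (h' : e.2 ≤ q.2) : False := by
  obtain ⟨m, ⟨hm, hml⟩, hme⟩ := exists_mem_height_eq (hA.inter (convex_left_of_line c s))
    ⟨hp, hpl⟩ ⟨hq, hql⟩ h h'
  have := hBA e he m hm hme.symm
  rw [Set.mem_ofPred_eq, hme] at hml
  linarith

/-- The mirror image of `not_between_of_left_of_line`. -/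
theorem not_between_of_right_of_line {A B : Set (ℝ × ℝ)} (hA : Convex ℝ A) (hAB : IsLeftOf A B)
    {c s : ℝ} {p q e : ℝ × ℝ} (hp : p ∈ A) (hq : q ∈ A) (he : e ∈ B)
    (hpl : c + s * p.2 < p.1) (hql : c + s * q.2 < q.1) (hel : e.1 < c + s * e.2)
    (h : p.2 ≤ e.2) (h' : e.2 ≤ q.2) : False := by
  obtain ⟨m, ⟨hm, hml⟩, hme⟩ := exists_mem_height_eq (hA.inter (convex_right_of_line c s))
    ⟨hp, hpl⟩ ⟨hq, hql⟩ h h'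
  have := hAB m hm e he hme
  rw [Set.mem_ofPred_eq, hme] at hml
  linarith

/-! ### The poset -/

/-- The elements of a quasi-convex poset that is not convex. -/
inductive Vertex
  | left (i : Fin 5)
  | right (i : Fin 5)
  | falling (k : Fin 4)
  | rising (k : Fin 4)
  | leftWall
  | rightWall
  | rake
  deriving DecidableEq, Fintype

namespace Vertex

/-- The abscissa of the point, at height `i + 1`, where `left i` and `right i` touch. -/
def tip : Fin 5 → ℤ := ![0, 2, -2, 2, 0]

/-- The drawing of the poset by spiked segments. -/
def toSpikedSegment : Vertex → SpikedSegment
  | left i =>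
    -- The shift by `i` only keeps the segments distinct.
    { base := -30 - i.val, slope := 0, lo := fun _ => -30 - i.val
      hi := fun k => if k = i then tip i else -30 - i.val
      lo_le := by simp
      le_hi := by revert i; decide }
  | right i =>
    { base := 30 + i.val, slope := 0, hi := fun _ => 30 + i.val
      lo := fun k => if k = i then tip i else 30 + i.val
      lo_le := by revert i; decide
      le_hi := by simp }
  | falling j =>
    -- Degenerate spikes. The line crosses abscissa 0 at height `j + 3/2`, midway between tips `j`
    -- and `j + 1`, and is steep enough to clear the tips at abscissae 2 and -2.
    { base := 6 * j.val + 9, slope := -6, lo := fun k => 6 * j.val + 9 + -6 * (k.val + 1)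
      hi := fun k => 6 * j.val + 9 + -6 * (k.val + 1)
      lo_le := fun _ => le_rfl
      le_hi := fun _ => le_rfl }
  | rising j =>
    { base := -6 * j.val - 9, slope := 6, lo := fun k => -6 * j.val - 9 + 6 * (k.val + 1)
      hi := fun k => -6 * j.val - 9 + 6 * (k.val + 1)
      lo_le := fun _ => le_rfl
      le_hi := fun _ => le_rfl }
  | leftWall =>
    { base := -1, slope := 0, lo := fun _ => -1, hi := fun _ => -1
      lo_le := by simp
      le_hi := by simp }
  | rightWall =>
    { base := 1, slope := 0, lo := fun _ => 1, hi := fun _ => 1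
      lo_le := by simp
      le_hi := by simp }
  | rake =>
    { base := -40, slope := 0, lo := fun _ => -40, hi := ![0, -40, -40, -40, 0]
      lo_le := by simp
      le_hi := by decide }

theorem eq_of_base_eq_of_slope_eq : ∀ v w : Vertex,
    v.toSpikedSegment.base = w.toSpikedSegment.base →
      v.toSpikedSegment.slope = w.toSpikedSegment.slope → v = w := by
  decide

theorem toSpikedSegment_injective : Function.Injective toSpikedSegment := fun v w h =>
  eq_of_base_eq_of_slope_eq v w (congrArg _ h) (congrArg _ h)

instance : PartialOrder Vertex :=
  PartialOrder.lift toSpikedSegment toSpikedSegment_injective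

theorem isQuasiConvexPoset : IsQuasiConvexPoset Vertex :=
  isQuasiConvexPoset_of_spikedSegment ⟨⟨toSpikedSegment, toSpikedSegment_injective⟩, Iff.rfl⟩
    eq_of_base_eq_of_slope_eq

/-- The strict order of the poset, in decidable form. -/
abbrev Before (v w : Vertex) : Prop := v.toSpikedSegment.LeftOf w.toSpikedSegment

/-- Incomparability in the poset, in decidable form. -/
abbrev Touch (v w : Vertex) : Prop := ¬ v.Before w ∧ ¬ w.Before v

theorem le_iff {v w : Vertex} (h : v ≠ w) : v ≤ w ↔ v.Before w :=
  ⟨fun hle => Or.resolve_left hle (toSpikedSegment_injective.ne h), Or.inr⟩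

theorem adj_iff {v w : Vertex} (h : v ≠ w) : (cocomparabilityGraph Vertex).Adj v w ↔ Touch v w := by
  change ¬ v ≤ w ∧ ¬ w ≤ v ↔ _
  rw [le_iff h, le_iff h.symm]

/-- A representation of the poset by convex sets between two horizontal lines. -/
structure ConvexRep (a b : ℝ) (A : Vertex → Set (ℝ × ℝ)) : Prop where
  lt : a < b
  convex : ∀ v, Convex ℝ (A v)
  spanned : ∀ v, SpannedBetween a b (A v)
  inter : ∀ v w, v ≠ w → (Touch v w ↔ (A v ∩ A w).Nonempty)

namespace ConvexRep

variable {a b : ℝ} {A : Vertex → Set (ℝ × ℝ)}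

theorem exists_line (hA : ConvexRep a b A) (v : Vertex) : ∃ c s : ℝ, ∀ t, a ≤ t → t ≤ b → (c + s * t, t) ∈ A v :=
  exists_line_subset (hA.convex v) hA.lt (hA.spanned v)

/-! ### Propagating the orientation -/

/-- This needs the middle set to have a point at every height of the strip, which its transversal
supplies. -/
theorem trans (hA : ConvexRep a b A) {u v w : Vertex} (h : IsLeftOf (A u) (A v)) (h' : IsLeftOf (A v) (A w)) :
    IsLeftOf (A u) (A w) := by
  intro p hp q hq hpq
  obtain ⟨c, s, hl⟩ := hA.exists_line v
  obtain ⟨h1, h2⟩ := (hA.spanned u).subset_strip p hp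
  have hm := hl p.2 h1 h2
  exact (h p hp _ hm rfl).trans (h' _ hm q hq hpq)

theorem not_isLeftOf (hA : ConvexRep a b A) {v w : Vertex} (h : Touch v w) : ¬ IsLeftOf (A v) (A w) := by
  obtain rfl | hne := eq_or_ne v w
  · obtain ⟨p, hp, -⟩ := (hA.spanned v).meets_lower
    exact fun h => (h p hp p hp rfl).false
  · obtain ⟨p, hp, hp'⟩ := (hA.inter v w hne).1 h
    exact fun h => (h p hp p hp' rfl).false

theorem isLeftOf_or (hA : ConvexRep a b A) {v w : Vertex} (h : v.Before w) :
    IsLeftOf (A v) (A w) ∨ IsLeftOf (A w) (A v) := by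
  have hne : v ≠ w := by rintro rfl; exact h.1.false
  refine isLeftOf_or_isLeftOf (hA.convex v) (hA.convex w) ?_
  rw [Set.disjoint_iff_inter_eq_empty, ← Set.not_nonempty_iff_eq_empty, ← hA.inter v w hne]
  exact fun ht => ht.1 h

/-- Otherwise `A w'` is left of `A v`, hence of `A w`, although the two sets meet. -/
theorem isLeftOf_right (hA : ConvexRep a b A) {v w w' : Vertex} (h : IsLeftOf (A v) (A w)) (hw : Touch w' w)
    (hv : v.Before w') : IsLeftOf (A v) (A w') :=
  (hA.isLeftOf_or hv).resolve_right fun h' => hA.not_isLeftOf hw (hA.trans h' h)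

theorem isLeftOf_left (hA : ConvexRep a b A) {v v' w : Vertex} (h : IsLeftOf (A v) (A w)) (hv : Touch v v')
    (hw : v'.Before w) : IsLeftOf (A v') (A w) :=
  (hA.isLeftOf_or hw).resolve_right fun h' => hA.not_isLeftOf hv (hA.trans h h')

theorem isLeftOf_left_right (hA : ConvexRep a b A) (h : IsLeftOf (A (left 0)) (A (right 1)))
    {i j : Fin 5} (hij : i ≠ j) : IsLeftOf (A (left i)) (A (right j)) := by
  have hleft : ∀ i j, Touch (left i) (left j) := by decide
  have hright : ∀ i j, Touch (right i) (right j) := by decide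
  have hlt : ∀ i j, i ≠ j → (left i).Before (right j) := by decide
  -- The route passes through `left 0` and `right j`, comparable only for `j ≠ 0`; the case `j = 0`
  -- is reached afterwards from another `k`.
  have h1 : ∀ i j, j ≠ 0 → i ≠ j → IsLeftOf (A (left i)) (A (right j)) := fun i j hj hij =>
    hA.isLeftOf_left (hA.isLeftOf_right h (hright j 1) (hlt 0 j hj.symm)) (hleft 0 i) (hlt i j hij)
  have hex : ∀ i : Fin 5, ∃ k : Fin 5, k ≠ 0 ∧ i ≠ k := by decide
  obtain ⟨k, hk, hik⟩ := hex i
  exact hA.isLeftOf_right (h1 i k hk hik) (hright j k) (hlt i j hij)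

theorem isLeftOf_of_left_before (hA : ConvexRep a b A)
    (h : IsLeftOf (A (left 0)) (A (right 1))) {i : Fin 5} {w : Vertex} (hw : (left i).Before w) :
    IsLeftOf (A (left i)) (A w) := by
  have key : ∀ i w, (left i).Before w → ∃ w', (left i).Before w' ∧ Touch w w' ∧
      ∃ j, i ≠ j ∧ Touch w' (right j) := by decide
  obtain ⟨w', hiw, hww, j, hij, hj⟩ := key i w hw
  exact hA.isLeftOf_right (hA.isLeftOf_right (hA.isLeftOf_left_right h hij) hj hiw) hww hw

theorem isLeftOf_of_before_right (hA : ConvexRep a b A)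
    (h : IsLeftOf (A (left 0)) (A (right 1))) {j : Fin 5} {w : Vertex} (hw : w.Before (right j)) :
    IsLeftOf (A w) (A (right j)) := by
  have key : ∀ j w, w.Before (right j) → ∃ w', w'.Before (right j) ∧ Touch w' w ∧
      ∃ i, i ≠ j ∧ Touch (left i) w' := by decide
  obtain ⟨w', hjw, hww, i, hij, hi⟩ := key j w hw
  exact hA.isLeftOf_left (hA.isLeftOf_left (hA.isLeftOf_left_right h hij) hi hjw) hww hw

theorem isLeftOf_rake_rightWall (hA : ConvexRep a b A) (h : IsLeftOf (A (left 0)) (A (right 1))) :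
    IsLeftOf (A rake) (A rightWall) :=
  hA.isLeftOf_left (hA.isLeftOf_of_left_before h (i := 0) (by decide)) (by decide) (by decide)

/-! ### Heights of the tips and the contradiction -/

theorem exists_tip (hA : ConvexRep a b A) (i : Fin 5) :
    ∃ p, p ∈ A (left i) ∧ p ∈ A (right i) :=
  (hA.inter _ _ (by simp)).1 (by revert i; decide)

theorem lt_of_mem_left (hA : ConvexRep a b A) (h : IsLeftOf (A (left 0)) (A (right 1)))
    {c s : ℝ} {w : Vertex} (hl : ∀ t, a ≤ t → t ≤ b → (c + s * t, t) ∈ A w) {i : Fin 5}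
    (hw : (left i).Before w) {p : ℝ × ℝ} (hp : p ∈ A (left i)) : p.1 < c + s * p.2 := by
  obtain ⟨h1, h2⟩ := (hA.spanned _).subset_strip p hp
  exact hA.isLeftOf_of_left_before h hw p hp _ (hl p.2 h1 h2) rfl

theorem lt_of_mem_right (hA : ConvexRep a b A) (h : IsLeftOf (A (left 0)) (A (right 1)))
    {c s : ℝ} {w : Vertex} (hl : ∀ t, a ≤ t → t ≤ b → (c + s * t, t) ∈ A w) {j : Fin 5}
    (hw : w.Before (right j)) {p : ℝ × ℝ} (hp : p ∈ A (right j)) : c + s * p.2 < p.1 := by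
  obtain ⟨h1, h2⟩ := (hA.spanned _).subset_strip p hp
  exact hA.isLeftOf_of_before_right h hw _ (hl p.2 h1 h2) p hp rfl

/-- The lines in `falling k` and `rising k` separate the heights of the tips up to `k` from those of
the later tips. -/
theorem exists_affine_separating_tips (hA : ConvexRep a b A)
    (h : IsLeftOf (A (left 0)) (A (right 1))) {e : Fin 5 → ℝ × ℝ}
    (he : ∀ i, e i ∈ A (left i) ∧ e i ∈ A (right i)) (k : Fin 4) :
    ∃ c s : ℝ, (∀ i ≤ k.castSucc, 0 < c + s * (e i).2) ∧
      ∀ i, k.castSucc < i → c + s * (e i).2 < 0 := by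
  have key : ∀ (k : Fin 4) (i : Fin 5),
      (i ≤ k.castSucc → (left i).Before (falling k) ∧ (rising k).Before (right i)) ∧
      (k.castSucc < i → (left i).Before (rising k) ∧ (falling k).Before (right i)) := by decide
  obtain ⟨c, s, hl⟩ := hA.exists_line (falling k)
  obtain ⟨c', s', hl'⟩ := hA.exists_line (rising k)
  refine ⟨c - c', s - s', fun i hi => ?_, fun i hi => ?_⟩
  · have h1 := hA.lt_of_mem_left h hl ((key k i).1 hi).1 (he i).1
    have h2 := hA.lt_of_mem_right h hl' ((key k i).1 hi).2 (he i).2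
    linarith
  · have h1 := hA.lt_of_mem_left h hl' ((key k i).2 hi).1 (he i).1
    have h2 := hA.lt_of_mem_right h hl ((key k i).2 hi).2 (he i).2
    linarith

/-- Each `k` gives an affine function of height, positive at tips up to `k` and negative at later
ones. Comparing tips 0 and 4 fixes the sign of its slope, the same for every `k`. -/
theorem tips_monotone (hA : ConvexRep a b A) (h : IsLeftOf (A (left 0)) (A (right 1)))
    {e : Fin 5 → ℝ × ℝ} (he : ∀ i, e i ∈ A (left i) ∧ e i ∈ A (right i)) :
    (∀ k : Fin 4, (e k.castSucc).2 < (e k.succ).2) ∨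
      ∀ k : Fin 4, (e k.succ).2 < (e k.castSucc).2 := by
  rcases le_total (e 0).2 (e 4).2 with h04 | h04
  · refine Or.inl fun k => ?_
    obtain ⟨c, s, hpos, hneg⟩ := hA.exists_affine_separating_tips h he k
    have h0 := hpos 0 (Fin.zero_le _)
    have h4 := hneg 4 k.castSucc_lt_last
    have hk := hpos _ le_rfl
    have hk' := hneg _ k.castSucc_lt_succ
    by_contra! hc
    have hs : s < 0 := by
      by_contra! hs
      linarith [mul_le_mul_of_nonneg_left h04 hs]
    linarith [mul_le_mul_of_nonpos_left hc hs.le]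
  · refine Or.inr fun k => ?_
    obtain ⟨c, s, hpos, hneg⟩ := hA.exists_affine_separating_tips h he k
    have h0 := hpos 0 (Fin.zero_le _)
    have h4 := hneg 4 k.castSucc_lt_last
    have hk := hpos _ le_rfl
    have hk' := hneg _ k.castSucc_lt_succ
    by_contra! hc
    have hs : 0 < s := by
      by_contra! hs
      linarith [mul_le_mul_of_nonpos_left h04 hs]
    linarith [mul_le_mul_of_nonneg_left hc hs.le]

theorem false_of_isLeftOf (hA : ConvexRep a b A) (h : IsLeftOf (A (left 0)) (A (right 1))) :
    False := by
  choose e he using hA.exists_tip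
  obtain ⟨p, hpr, hp⟩ := (hA.inter rake (right 0) (by simp)).1 (by decide)
  obtain ⟨q, hqr, hq⟩ := (hA.inter rake (right 4) (by simp)).1 (by decide)
  obtain ⟨c, s, hl⟩ := hA.exists_line rightWall
  obtain ⟨c', s', hl'⟩ := hA.exists_line leftWall
  have hrake : ∀ z ∈ A rake, z.1 < c + s * z.2 := fun z hz => by
    obtain ⟨h1, h2⟩ := (hA.spanned _).subset_strip z hz
    exact hA.isLeftOf_rake_rightWall h z hz _ (hl z.2 h1 h2) rfl
  have hpl := hrake p hpr
  have hql := hrake q hqr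
  have hpl' := hA.lt_of_mem_right h hl' (by decide) hp
  have hql' := hA.lt_of_mem_right h hl' (by decide) hq
  have he0 := hA.lt_of_mem_left h hl (by decide) (he 0).1
  have he1 := hA.lt_of_mem_right h hl (by decide) (he 1).2
  have he2 := hA.lt_of_mem_left h hl' (by decide) (he 2).1
  have he3 := hA.lt_of_mem_right h hl (by decide) (he 3).2
  have he4 := hA.lt_of_mem_left h hl (by decide) (he 4).1
  have h10 := hA.isLeftOf_left_right h (show (1 : Fin 5) ≠ 0 by decide)
  have h34 := hA.isLeftOf_left_right h (show (3 : Fin 5) ≠ 4 by decide)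
  have hr2 : IsLeftOf (A rake) (A (right 2)) := hA.isLeftOf_of_before_right h (by decide)
  rcases hA.tips_monotone h he with hmono | hmono <;>
    have m0 : _ < _ := hmono 0 <;> have m1 : _ < _ := hmono 1 <;>
    have m2 : _ < _ := hmono 2 <;> have m3 : _ < _ := hmono 3
  -- Otherwise `right 0`, through tip 0 and `p`, would pass left of the right wall at the height of
  -- tip 1, although `left 1` is left of it.
  · have h1 : p.2 < (e 1).2 := by
      by_contra! hc
      exact not_between_of_left_of_line (hA.convex _) h10 (he 0).2 hp (he 1).1 he0 hpl he1 m0.le hc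
    have h3 : (e 3).2 < q.2 := by
      by_contra! hc
      exact not_between_of_left_of_line (hA.convex _) h34 hq (he 4).2 (he 3).1 hql he4 he3 hc m3.le
    -- The rake contains `p` and `q`, both right of the left wall, on either side of the height of
    -- tip 2.
    exact not_between_of_right_of_line (hA.convex _) hr2 hpr hqr (he 2).2 hpl' hql' he2
      (h1.trans m1).le (m2.trans h3).le
  · have h1 : (e 1).2 < p.2 := by
      by_contra! hc
      exact not_between_of_left_of_line (hA.convex _) h10 hp (he 0).2 (he 1).1 hpl he0 he1 hc m0.le
    have h3 : q.2 < (e 3).2 := by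
      by_contra! hc
      exact not_between_of_left_of_line (hA.convex _) h34 (he 4).2 hq (he 3).1 he4 hql he3 m3.le hc
    exact not_between_of_right_of_line (hA.convex _) hr2 hqr hpr (he 2).2 hql' hpl' he2
      (h3.trans m2).le (m1.trans h1).le

theorem reflect (hA : ConvexRep a b A) :
    ConvexRep a b fun v => (fun p : ℝ × ℝ => (-p.1, p.2)) '' A v where
  lt := hA.lt
  convex v := (hA.convex v).is_linear_image
    ⟨fun _ _ => by ext <;> simp [add_comm], fun _ _ => by ext <;> simp⟩
  spanned v := by
    obtain ⟨h1, h2, ⟨p, hp, hpa⟩, q, hq, hqb⟩ := hA.spanned v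
    refine ⟨h1.image (by fun_prop), ?_, ⟨_, ⟨p, hp, rfl⟩, hpa⟩, _, ⟨q, hq, rfl⟩, hqb⟩
    rintro _ ⟨p, hp, rfl⟩
    exact h2 p hp
  inter v w hvw := by
    have hinj : Function.Injective fun p : ℝ × ℝ => (-p.1, p.2) := fun p q h => by
      simpa [Prod.ext_iff] using h
    rw [← Set.image_inter hinj, Set.image_nonempty]
    exact hA.inter v w hvw

theorem elim (hA : ConvexRep a b A) : False := by
  obtain h | h := hA.isLeftOf_or (show (left 0).Before (right 1) by decide)
  · exact hA.false_of_isLeftOf h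
  · refine hA.reflect.false_of_isLeftOf ?_
    rintro _ ⟨p, hp, rfl⟩ _ ⟨q, hq, rfl⟩ hpq
    exact neg_lt_neg (h q hq p hp hpq.symm)

end ConvexRep

theorem not_isConvexPoset : ¬ IsConvexPoset Vertex := by
  rintro ⟨a, b, hab, F, hF, φ, hφ⟩
  exact ConvexRep.elim (A := fun v => (φ v : Set (ℝ × ℝ)))
    ⟨hab, fun v => (hF _ (φ v).2).2, fun v => (hF _ (φ v).2).1, fun v w hvw => by
      rw [← hφ v w hvw, adj_iff hvw]⟩

end Vertex

theorem mainTheorem5 :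
    (∀ (P : Type*) [PartialOrder P], IsConvexPoset P → IsQuasiConvexPoset P) ∧
      ∃ (P : Type) (_ : PartialOrder P), Finite P ∧ IsQuasiConvexPoset P ∧ ¬ IsConvexPoset P := by
  exact ⟨fun P _ h => h.isQuasiConvexPoset, Vertex, inferInstance, inferInstance,
    Vertex.isQuasiConvexPoset, Vertex.not_isConvexPoset⟩
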